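/- Let $k\ge 1$ and $n\ge k$. The input is a uniformly random permutation $(e_1,\dots,e_n)$ of $\{1,\dots,n\}$; the pivots are $e_1,\dots,e_k$, in sorted order $p_1<\dots<p_k$. An element $e_i$ with $i>k$ belongs to group $A_h$ ($0\le h\le k$) if exactly $h$ pivots are smaller than it, and $a_h=|A_h|$. A *comparison tree* is a binary search tree with inner nodes $p_1,\dots,p_k$ in inorder and leaves $A_0,\dots,A_k$ from left to right; classifying an element of $A_h$ with the comparison tree $\lambda$ takes $\mathrm{depth}_\lambda(A_h)$ comparisons. Let $\mathrm{cost}^\lambda(b_0,\dots,b_k)=\sum_{h}\mathrm{depth}_\lambda(A_h)\,b_h$. A *classification tree* is a $(k+1)$-way tree in which every inner node $v$ carries an index $i(v)\in\{k+1,\dots,n\}$ and a comparison tree $\lambda(v)$, every index occurring exactly once on each path from the root to a leaf; at $v$ the element $e_{i(v)}$ is classified with $\lambda(v)$, and one continues in the $h$-th child if $e_{i(v)}\in A_h$. Let $a^v_h$ be the number of edges labeled $h$ on the path from the root to $v$. A classification strategy is given by a classification tree, which for the strategies $\mathcal O_k$ and $\mathcal N_k$ below may depend on $(a_0,\dots,a_k)$.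 Its average comparison count $\mathrm E(P_n)$ is the expected total number of comparisons made when classifying $e_{k+1},\dots,e_n$. Consider the following strategies, where the order of classification and the choice among cost-minimal comparison trees are arbitrary. * $\mathcal O_k$: given $a_0,\dots,a_k$, at every node $v$ that can be reached, $\lambda(v)$ minimizes $\mathrm{cost}^\lambda(a_0-a^v_0,\dots,a_k-a^v_k)$ over all comparison trees $\lambda$. * $\mathcal N_k$: given $a_0,\dots,a_k$, at every node $v$, $\lambda(v)$ minimizes $\mathrm{cost}^\lambda(a_0,\dots,a_k)$ over all comparison trees $\lambda$. * $\mathcal{SP}_k$ (which does not know $a_0,\dots,a_k$): with an arbitrary comparison tree $\lambda_0$, the first $n^{3/4}$ elements (rounded up or down; all elements if there are fewer) are classified with $\lambda_0$. Let $a'_0,\dots,a'_k$ be the numbers of these elements found in $A_0,\dots,A_k$. All remaining elements are classified with one comparison tree that minimizes $\mathrm{cost}^\lambda(a'_0,\dots,a'_k)$. **Theorem.** The strategy $\mathcal{SP}_k$ is asymptotically optimal for every $k\ge1$, that is, its average comparison count differs from that of $\mathcal O_k$ by $O(n^{1-\varepsilon})$; likewise it differs from that of $\mathcal N_k$ by $O(n^{1-\varepsilon})$.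 Precisely, there is $\varepsilon>0$ such that for every $k\ge 1$ there is a constant $C$ such that for all $n\ge k$, for every choice of $\lambda_0$ and of the classification orders and cost-minimal trees in the strategies, $$\bigl|\mathrm E(P_n^{\mathcal{SP}_k})-\mathrm E(P_n^{\mathcal O_k})\bigr|\le C\,n^{1-\varepsilon}\quad\text{and}\quad\bigl|\mathrm E(P_n^{\mathcal{SP}_k})-\mathrm E(P_n^{\mathcal N_k})\bigr|\le C\,n^{1-\varepsilon}.$$ -/

import Mathlib

open scoped Nat

namespace KPivot

/-- Binary search trees whose leaves are, from left to right, the groups `A_a, …, A_b`, and whose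
inner nodes are, in inorder, the pivots `p_{a+1}, …, p_b`. The root of `node j l r` is `p_{j+1}`. -/
inductive SearchTree : ℕ → ℕ → Type
  | leaf (a : ℕ) : SearchTree a a
  | node {a b : ℕ} (j : ℕ) (l : SearchTree a j) (r : SearchTree (j + 1) b) : SearchTree a b

/-- The comparison trees for `k` pivots (the set `Λ_k`). -/
abbrev ComparisonTree (k : ℕ) : Type := SearchTree 0 k

/-- The depth of the leaf `A_h`: the number of comparisons made when searching for an element of
`A_h`. At a node `p_{j+1}` the search goes left if and only if the element is smaller than
`p_{j+1}`, that is, if and only if `h ≤ j`. -/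
def SearchTree.depth : {a b : ℕ} → SearchTree a b → ℕ → ℕ
  | _, _, .leaf _, _ => 0
  | _, _, .node j l r, h => 1 + if h ≤ j then l.depth h else r.depth h

/-- `cost^t(a_0, …, a_k) = ∑ h, depth_t(A_h) * a_h`. -/
def cost {k : ℕ} (t : ComparisonTree k) (a : Fin (k + 1) → ℕ) : ℕ :=
  ∑ h : Fin (k + 1), t.depth h.val * a h

/-- `t` has minimal cost for the group sizes `a` among all comparison trees. -/
def IsCostMinimal {k : ℕ} (a : Fin (k + 1) → ℕ) (t : ComparisonTree k) : Prop :=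
  ∀ t' : ComparisonTree k, cost t a ≤ cost t' a

/-- Classification trees in which the elements at the positions in `s` are still unclassified.
A node carries the position `i` of the element to be classified next and the comparison tree `t`
used for it, and has one child for each outcome; on every path to a leaf each position in `s`
occurs exactly once. -/
inductive ClassificationTree (k : ℕ) {n : ℕ} : Finset (Fin n) → Type
  | leaf : ClassificationTree k ∅
  | node {s : Finset (Fin n)} (i : Fin n) (hi : i ∈ s) (t : ComparisonTree k)
      (child : Fin (k + 1) → ClassificationTree k (s.erase i)) : ClassificationTree k s

/-- The number of comparisons made in the classification, where `g i` is the group of the element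
at position `i`. -/
def ClassificationTree.comparisons {k n : ℕ} (g : Fin n → Fin (k + 1)) :
    {s : Finset (Fin n)} → ClassificationTree k s → ℕ
  | _, .leaf => 0
  | _, .node i _ t child => t.depth (g i).val + (child (g i)).comparisons g

/-- Every inner node `v` satisfies `P c t`, where `t` is its comparison tree and `c h` is the number
of edges labeled `h` on the path to `v`; the argument `c` is this count for the root. -/
def ClassificationTree.AllNodes {k n : ℕ} (P : (Fin (k + 1) → ℕ) → ComparisonTree k → Prop) :
    {s : Finset (Fin n)} → ClassificationTree k s → (Fin (k + 1) → ℕ) → Prop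
  | _, .leaf, _ => True
  | _, .node _ _ t child, c => P c t ∧ ∀ h, (child h).AllNodes P (c + Pi.single h 1)

/-- The positions of the elements to be classified; the positions `0, …, k - 1` hold the pivots. -/
def nonPivots (n k : ℕ) : Finset (Fin n) := Finset.univ.filter fun i => k ≤ i.val

/-- The group of the element `σ i` of the input `σ`: the number of pivots smaller than it. -/
def group {n : ℕ} (k : ℕ) (σ : Equiv.Perm (Fin n)) (i : Fin n) : Fin (k + 1) :=
  ⟨(Finset.univ.filter fun j : Fin n => j.val < k ∧ σ j < σ i).card, by
    have h : (Finset.univ.filter fun j : Fin n => j.val < k ∧ σ j < σ i).card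
        ≤ (Finset.range k).card :=
      Finset.card_le_card_of_injOn (fun j => j.val)
        (fun j hj => by simp at hj ⊢; exact hj.1) (fun _ _ _ _ h => Fin.ext h)
    rw [Finset.card_range] at h
    exact Nat.lt_succ_of_le h⟩

/-- The size `a_h` of the group `A_h`. -/
def groupSize {n : ℕ} (k : ℕ) (σ : Equiv.Perm (Fin n)) (h : Fin (k + 1)) : ℕ :=
  ((nonPivots n k).filter fun i => group k σ i = h).card

/-- Strategies that may know the group sizes: a classification tree for each vector of group
sizes. A strategy that does not know them is a constant function. -/
abbrev Strategy (k n : ℕ) : Type := (Fin (k + 1) → ℕ) → ClassificationTree k (nonPivots n k)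

/-- The average comparison count of a strategy over all permutations of an input of length `n`. -/
noncomputable def avgComparisons {k n : ℕ} (S : Strategy k n) : ℝ :=
  (∑ σ : Equiv.Perm (Fin n), ((S (groupSize k σ)).comparisons (group k σ) : ℝ)) / (n ! : ℝ)

/-- The strategy `O_k`: the comparison tree at a node is one with minimal cost for the group sizes
of the unclassified elements. (A node with `c h > a h` for some `h` is never reached.) -/
def IsO {k n : ℕ} (S : Strategy k n) : Prop :=
  ∀ a : Fin (k + 1) → ℕ, ∑ h, a h = n - k →
    (S a).AllNodes (fun c t => c ≤ a → IsCostMinimal (a - c) t) 0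

/-- The strategy `N_k`: the comparison tree at a node is one with minimal cost for the group
sizes of the input. -/
def IsN {k n : ℕ} (S : Strategy k n) : Prop :=
  ∀ a : Fin (k + 1) → ℕ, ∑ h, a h = n - k → (S a).AllNodes (fun _ t => IsCostMinimal a t) 0

/-- The next `m` elements are classified with `t₀`, and all elements after them with one comparison
tree that has minimal cost for the numbers of elements found in each group so far; the argument `c`
holds these numbers for the elements classified already. -/
def ClassificationTree.SamplesThenFixes {k n : ℕ} (t₀ : ComparisonTree k) :
    {s : Finset (Fin n)} → ClassificationTree k s → ℕ → (Fin (k + 1) → ℕ) → Prop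
  | _, T, 0, c => ∃ t, IsCostMinimal c t ∧ T.AllNodes (fun _ t' => t' = t) c
  | _, .leaf, _ + 1, _ => True
  | _, .node _ _ t child, m + 1, c =>
      t = t₀ ∧ ∀ h, (child h).SamplesThenFixes t₀ m (c + Pi.single h 1)

/-- The strategy `SP_k` with initial comparison tree `t₀`; the sample size `n^{3/4}` may be rounded
up or down. -/
def IsSP {k n : ℕ} (t₀ : ComparisonTree k) (T : ClassificationTree k (nonPivots n k)) : Prop :=
  ∃ m : ℕ, |(m : ℝ) - (n : ℝ) ^ (3 / 4 : ℝ)| < 1 ∧ T.SamplesThenFixes t₀ m 0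

end KPivot

namespace KPivot

/-! Fix the group sizes `a`, put m = n - k, and let M be the minimal cost for `a`. Averaged over the
inputs with these sizes, each strategy makes M + O(n^{3/4}) comparisons, so any two of them are that
close.

Given the sizes, the non-pivots are exchangeable: if j elements are unclassified, `R h` of them in
group h, the next one lies in group h with probability `R h / j`, whatever its position
(`IsExchangeable.card_filter_div`). Classification is thus drawing from an urn without replacement,
and the order is irrelevant. The squared deviation U of `R` from the proportions of `a` starts at 0,
and one draw turns it into at most (1 - 1/j)² U + 1 on average (`sum_mul_deviation_le`).

For O and N, a tree optimal for `R` or for `a` costs jM/m on `R`, up to k times the ℓ¹ deviation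
(`abs_realCost_sub_mul_le`). Summing the errors per element gives O(m/l + l·H), with a free
parameter l > 0 and H the harmonic sum. For SP, a sample of size S costs O(S) and leaves expected
squared deviation at most S, so the tree chosen from it has cost M + O(m/l + ml/S) on the input
(`abs_cost_sub_cost_le`). With S near n^{3/4}, l = n^{1/4} makes every term O(n^{3/4}). -/

theorem SearchTree.le {a b : ℕ} (t : SearchTree a b) : a ≤ b := by
  induction t with
  | leaf => exact le_rfl
  | node j l r ihl ihr => omega

theorem SearchTree.depth_le {a b : ℕ} (t : SearchTree a b) (h : ℕ) : t.depth h ≤ b - a := by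
  induction t with
  | leaf => simp [SearchTree.depth]
  | node j l r ihl ihr =>
    have := l.le
    have := r.le
    simp only [SearchTree.depth]
    split_ifs <;> omega

theorem ComparisonTree.depth_le {k : ℕ} (t : ComparisonTree k) (h : ℕ) :
    (t.depth h : ℝ) ≤ k := by
  exact_mod_cast SearchTree.depth_le t h

/-- Costs are natural numbers, so a minimum exists without finiteness of the set of trees; `t₀`
supplies nonemptiness. -/
theorem exists_isCostMinimal {k : ℕ} (t₀ : ComparisonTree k) (a : Fin (k + 1) → ℕ) :
    ∃ t, IsCostMinimal a t := by
  obtain ⟨t, -, ht⟩ := (measure fun t : ComparisonTree k => cost t a).wf.has_min Set.univ ⟨t₀, trivial⟩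
  exact ⟨t, fun t' => not_lt.mp (ht t' trivial)⟩

/-! ### Cost as a linear form with coefficients in [0, k] -/

/-- The cost of a comparison tree for real weights of the groups. -/
noncomputable def realCost {k : ℕ} (t : ComparisonTree k) (x : Fin (k + 1) → ℝ) : ℝ :=
  ∑ h : Fin (k + 1), (t.depth h.val : ℝ) * x h

theorem cast_cost {k : ℕ} (t : ComparisonTree k) (a : Fin (k + 1) → ℕ) :
    (cost t a : ℝ) = realCost t fun h => (a h : ℝ) := by
  simp [cost, realCost]

theorem realCost_smul {k : ℕ} (t : ComparisonTree k) (r : ℝ) (x : Fin (k + 1) → ℝ) :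
    realCost t (fun h => r * x h) = r * realCost t x := by
  simp only [realCost, Finset.mul_sum]
  exact Finset.sum_congr rfl fun h _ => by ring

theorem abs_realCost_sub_le {k : ℕ} (t : ComparisonTree k) (x y : Fin (k + 1) → ℝ) :
    |realCost t x - realCost t y| ≤ k * ∑ h, |x h - y h| := by
  simp only [realCost, ← Finset.sum_sub_distrib, ← mul_sub, Finset.mul_sum]
  refine (Finset.abs_sum_le_sum_abs _ _).trans (Finset.sum_le_sum fun h _ => ?_)
  rw [abs_mul, Nat.abs_cast]
  exact mul_le_mul_of_nonneg_right (ComparisonTree.depth_le t h) (abs_nonneg _)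

theorem cost_le {k : ℕ} (t : ComparisonTree k) (a : Fin (k + 1) → ℕ) :
    cost t a ≤ k * ∑ h, a h := by
  rw [cost, Finset.mul_sum]
  exact Finset.sum_le_sum fun h _ => Nat.mul_le_mul_right _ (SearchTree.depth_le t h)

/-! ### Squared deviation and its evolution under random draws -/

/-- The sum of the squared deviations of group sizes `x` from the proportions `q` of `j`. -/
noncomputable def deviation {k : ℕ} (q : Fin (k + 1) → ℝ) (j : ℝ) (x : Fin (k + 1) → ℝ) : ℝ :=
  ∑ h, (x h - j * q h) ^ 2

theorem deviation_nonneg {k : ℕ} (q : Fin (k + 1) → ℝ) (j : ℝ) (x : Fin (k + 1) → ℝ) :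
    0 ≤ deviation q j x :=
  Finset.sum_nonneg fun _ _ => sq_nonneg _

/-- AM-GM with a free parameter `l` takes the place of Cauchy–Schwarz: the bound is affine in the
squared deviation, so it can be averaged over outcomes in an induction without square roots of
expectations. -/
theorem sum_abs_div_le {k : ℕ} (q : Fin (k + 1) → ℝ) (j : ℝ) (x : Fin (k + 1) → ℝ)
    {l d : ℝ} (hl : 0 < l) (hd : 0 < d) :
    (∑ h, |x h - j * q h|) / d ≤ 1 / 2 * ((k + 1) / l + l * (deviation q j x / d ^ 2)) := by
  have key : ∀ y : ℝ, |y| / d ≤ 1 / 2 * (1 / l + l * (y ^ 2 / d ^ 2)) := by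
    intro y
    have h1 : 1 / 2 * (1 / l + l * (y ^ 2 / d ^ 2)) - |y| / d
        = (l * (|y| / d) - 1) ^ 2 / (2 * l) := by
      rw [← sq_abs y]
      field_simp
      ring
    have h2 : 0 ≤ (l * (|y| / d) - 1) ^ 2 / (2 * l) := by positivity
    linarith
  calc (∑ h, |x h - j * q h|) / d = ∑ h, |x h - j * q h| / d := Finset.sum_div _ _ _
    _ ≤ ∑ h, 1 / 2 * (1 / l + l * ((x h - j * q h) ^ 2 / d ^ 2)) :=
        Finset.sum_le_sum fun h _ => key _
    _ = _ := by
        rw [← Finset.mul_sum, Finset.sum_add_distrib, ← Finset.mul_sum, Finset.sum_const,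
          Finset.card_univ, Fintype.card_fin, deviation, Finset.sum_div, nsmul_eq_mul]
        push_cast
        ring

/-- Removing a random element changes the expected squared deviation in a controlled way. -/
theorem sum_mul_deviation_le {k : ℕ} (q x : Fin (k + 1) → ℝ) {j : ℝ} (hj : 0 < j)
    (hx : ∑ h, x h = j) :
    ∑ h, x h / j * deviation q (j - 1) (fun h' => x h' - (Pi.single h 1 : Fin (k + 1) → ℝ) h')
      ≤ (1 - 1 / j) ^ 2 * deviation q j x + 1 := by
  -- Second moment as squared mean plus variance: the mean of the new entry is (1 - 1/j)(x h' - j q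
  -- h'), and the removed indicator has variance p - p² with p = x h' / j. These variances sum to at
  -- most 1.
  have inner : ∀ h', ∑ h, x h / j * (x h' - (Pi.single h 1 : Fin (k + 1) → ℝ) h'
      - (j - 1) * q h') ^ 2 = (1 - 1 / j) ^ 2 * (x h' - j * q h') ^ 2
        + (x h' / j - (x h' / j) ^ 2) := by
    intro h'
    have e : ∀ h, x h / j * (x h' - (Pi.single h 1 : Fin (k + 1) → ℝ) h' - (j - 1) * q h') ^ 2
        = x h / j * (x h' - (j - 1) * q h') ^ 2
          + if h = h' then x h / j * (1 - 2 * (x h' - (j - 1) * q h')) else 0 := by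
      intro h
      by_cases hh : h = h'
      · subst hh; simp; ring
      · rw [Pi.single_eq_of_ne (Ne.symm hh)]; simp [hh]
    rw [Finset.sum_congr rfl fun h _ => e h, Finset.sum_add_distrib, ← Finset.sum_mul,
      ← Finset.sum_div, hx, Finset.sum_ite_eq' Finset.univ h']
    simp only [Finset.mem_univ, if_true]
    field_simp
    ring
  simp only [deviation, Finset.mul_sum]
  rw [Finset.sum_comm, Finset.sum_congr rfl fun h' _ => inner h', Finset.sum_add_distrib,
    Finset.sum_sub_distrib, ← Finset.sum_div, hx, div_self hj.ne']
  have : 0 ≤ ∑ h, (x h / j) ^ 2 := Finset.sum_nonneg fun _ _ => sq_nonneg _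
  linarith

/-- A logarithmic bound is not needed: multiplied by l = n^{1/4}, the square root already gives
n^{3/4}. The term `i = 0` is 0. -/
theorem sum_inv_le_two_mul_sqrt (m : ℕ) :
    ∑ i ∈ Finset.range m, (i : ℝ)⁻¹ ≤ 2 * √(m : ℝ) := by
  have key : ∀ j : ℕ, ∑ i ∈ Finset.range (j + 1), (i : ℝ)⁻¹ ≤ 2 * √(j : ℝ) := by
    intro j
    induction j with
    | zero => simp
    | succ j ih =>
      rw [Finset.sum_range_succ]
      have h1 : 0 < √((j + 1 : ℕ) : ℝ) := Real.sqrt_pos.mpr (by positivity)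
      have h2 := Real.sq_sqrt (Nat.cast_nonneg (α := ℝ) (j + 1))
      have h3 := Real.sq_sqrt (Nat.cast_nonneg (α := ℝ) j)
      have h0 := Real.sqrt_nonneg (j : ℝ)
      set u := √((j + 1 : ℕ) : ℝ)
      set v := √(j : ℝ)
      push_cast at h2 ⊢
      have h4 : u ^ 2 = v ^ 2 + 1 := by linarith
      have hu1 : 1 ≤ u := by nlinarith
      have huv : v ≤ u := by nlinarith
      -- Telescoping: u - v = 1/(u + v) ≥ 1/(2u), and 1/u ≥ 1/u² because u ≥ 1.
      have : ((j : ℝ) + 1)⁻¹ ≤ 2 * (u - v) := by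
        rw [← h2, inv_le_iff_one_le_mul₀ (by positivity)]
        have : 1 = (u - v) * (u + v) := by linarith
        nlinarith [mul_nonneg (sub_nonneg.mpr huv) (sub_nonneg.mpr huv),
          mul_nonneg (sub_nonneg.mpr huv) (mul_nonneg h1.le (sub_nonneg.mpr hu1))]
      linarith
  cases m with
  | zero => simp
  | succ j =>
    refine (key j).trans ?_
    gcongr
    simp

/-! ### Exchangeability of the unclassified elements -/

/-- The inputs in `A` have `R h` elements of the group `h` at the positions in `s`, and `A` is
closed under exchanging these elements. -/
structure IsExchangeable {n k : ℕ} (s : Finset (Fin n)) (R : Fin (k + 1) → ℕ)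
    (A : Finset (Equiv.Perm (Fin n))) : Prop where
  subset : s ⊆ nonPivots n k
  swap : ∀ i ∈ s, ∀ j ∈ s, ∀ σ ∈ A, σ * Equiv.swap i j ∈ A
  count : ∀ σ ∈ A, ∀ h, (s.filter fun i => group k σ i = h).card = R h

theorem group_mul_swap {n k : ℕ} {i j : Fin n} (hi : i ∈ nonPivots n k) (hj : j ∈ nonPivots n k)
    (σ : Equiv.Perm (Fin n)) (x : Fin n) :
    group k (σ * Equiv.swap i j) x = group k σ (Equiv.swap i j x) := by
  simp only [nonPivots, Finset.mem_filter, Finset.mem_univ, true_and] at hi hj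
  refine Fin.ext ?_
  simp only [group, Equiv.Perm.mul_apply]
  congr 1
  refine Finset.filter_congr fun y _ => and_congr_right fun hy => ?_
  rw [Equiv.swap_apply_of_ne_of_ne]
  · rintro rfl; omega
  · rintro rfl; omega

namespace IsExchangeable

variable {n k : ℕ} {s : Finset (Fin n)} {R : Fin (k + 1) → ℕ} {A : Finset (Equiv.Perm (Fin n))}

theorem sum_eq (hA : IsExchangeable s R A) (hne : A.Nonempty) : ∑ h, R h = s.card := by
  obtain ⟨σ, hσ⟩ := hne
  rw [Finset.card_eq_sum_card_fiberwise (f := group k σ) (t := Finset.univ) (by simp)]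
  exact Finset.sum_congr rfl fun h _ => (hA.count σ hσ h).symm

theorem card_filter_eq (hA : IsExchangeable s R A) {i j : Fin n} (hi : i ∈ s) (hj : j ∈ s)
    (h : Fin (k + 1)) :
    (A.filter fun σ => group k σ j = h).card = (A.filter fun σ => group k σ i = h).card := by
  refine Finset.card_bij (fun σ _ => σ * Equiv.swap i j) ?_ ?_ ?_
  · intro σ hσ
    rw [Finset.mem_filter] at hσ ⊢
    exact ⟨hA.swap i hi j hj σ hσ.1, by
      rw [group_mul_swap (hA.subset hi) (hA.subset hj), Equiv.swap_apply_left, hσ.2]⟩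
  · intro σ _ τ _ e
    exact mul_right_cancel e
  · intro σ hσ
    rw [Finset.mem_filter] at hσ
    refine ⟨σ * Equiv.swap i j, ?_, by simp [mul_assoc]⟩
    rw [Finset.mem_filter]
    exact ⟨hA.swap i hi j hj σ hσ.1, by
      rw [group_mul_swap (hA.subset hi) (hA.subset hj), Equiv.swap_apply_right, hσ.2]⟩

/-- Double counting of pairs of an input in `A` and a position in `s` holding an element of group
`h`; by exchangeability all positions contribute equally. -/
theorem card_mul_card_filter (hA : IsExchangeable s R A) {i : Fin n} (hi : i ∈ s)
    (h : Fin (k + 1)) :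
    s.card * (A.filter fun σ => group k σ i = h).card = R h * A.card := by
  calc s.card * (A.filter fun σ => group k σ i = h).card
      = ∑ j ∈ s, (A.filter fun σ => group k σ j = h).card := by
        rw [Finset.sum_congr rfl fun j hj => hA.card_filter_eq hi hj h, Finset.sum_const,
          smul_eq_mul]
    _ = ∑ σ ∈ A, (s.filter fun j => group k σ j = h).card := by
        simp only [Finset.card_filter]
        exact Finset.sum_comm
    _ = R h * A.card := by
        rw [Finset.sum_congr rfl fun σ hσ => hA.count σ hσ h, Finset.sum_const, smul_eq_mul,
          mul_comm]

theorem card_filter_div (hA : IsExchangeable s R A) {i : Fin n} (hi : i ∈ s)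
    (h : Fin (k + 1)) :
    ((A.filter fun σ => group k σ i = h).card : ℝ) = R h / s.card * A.card := by
  have hs : (s.card : ℝ) ≠ 0 := by
    exact_mod_cast (Finset.card_pos.mpr ⟨i, hi⟩).ne'
  rw [div_mul_eq_mul_div, eq_div_iff hs, mul_comm]
  exact_mod_cast hA.card_mul_card_filter hi h

/-- Conditioning on one outcome preserves exchangeability of the rest, since the remaining swaps fix
position `i`. Truncated subtraction is harmless: if `R h = 0`, no input has this outcome. -/
theorem child (hA : IsExchangeable s R A) {i : Fin n} (hi : i ∈ s) (h : Fin (k + 1)) :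
    IsExchangeable (s.erase i) (R - Pi.single h 1) (A.filter fun σ => group k σ i = h) where
  subset := (Finset.erase_subset _ _).trans hA.subset
  swap := by
    intro x hx y hy σ hσ
    rw [Finset.mem_filter] at hσ ⊢
    rw [Finset.mem_erase] at hx hy
    refine ⟨hA.swap x hx.2 y hy.2 σ hσ.1, ?_⟩
    rw [group_mul_swap (hA.subset hx.2) (hA.subset hy.2),
      Equiv.swap_apply_of_ne_of_ne (Ne.symm hx.1) (Ne.symm hy.1), hσ.2]
  count := by
    intro σ hσ h'
    rw [Finset.mem_filter] at hσ
    rw [Finset.filter_erase, Pi.sub_apply, ← hA.count σ hσ.1 h']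
    by_cases hh : h' = h
    · subst hh
      rw [Pi.single_eq_same, Finset.card_erase_of_mem (by simp [hi, hσ.2])]
    · rw [Pi.single_eq_of_ne hh, Finset.erase_eq_of_notMem, Nat.sub_zero]
      simp [hσ.2, Ne.symm hh]

theorem pos_of_mem_filter (hA : IsExchangeable s R A) {i : Fin n} (hi : i ∈ s)
    {h : Fin (k + 1)} (hne : (A.filter fun σ => group k σ i = h).Nonempty) : 0 < R h := by
  obtain ⟨σ, hσ⟩ := hne
  rw [Finset.mem_filter] at hσ
  rw [← hA.count σ hσ.1 h]
  exact Finset.card_pos.mpr ⟨i, by simp [hi, hσ.2]⟩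

/-- One step of the classification: if the average of `F` over the inputs with outcome `h` for the
element at position `i` is close to `μ`, the error terms are averaged. -/
theorem abs_sum_node_sub_le (hA : IsExchangeable s R A) {i : Fin n} (hi : i ∈ s)
    (t : ComparisonTree k) (F : Fin (k + 1) → Equiv.Perm (Fin n) → ℝ)
    (μ : ℝ) (B : Fin (k + 1) → ℝ)
    (hF : ∀ h, (A.filter fun σ => group k σ i = h).Nonempty →
      |∑ σ ∈ A.filter (fun σ => group k σ i = h), F h σ
        - (A.filter fun σ => group k σ i = h).card * μ|
        ≤ (A.filter fun σ => group k σ i = h).card * B h) :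
    |∑ σ ∈ A, ((t.depth (group k σ i).val : ℝ) + F (group k σ i) σ)
        - A.card * (realCost t (fun h => (R h : ℝ)) / s.card + μ)|
      ≤ A.card * ∑ h, (R h : ℝ) / s.card * B h := by
  have hc : (A.card : ℝ) = ∑ h, ((A.filter fun σ => group k σ i = h).card : ℝ) := by
    exact_mod_cast Finset.card_eq_sum_card_fiberwise (f := fun σ => group k σ i) (t := Finset.univ)
      (s := A) (by simp)
  have e1 : ∑ σ ∈ A, ((t.depth (group k σ i).val : ℝ) + F (group k σ i) σ)
      = ∑ h, (((A.filter fun σ => group k σ i = h).card : ℝ) * t.depth h.val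
        + ∑ σ ∈ A.filter (fun σ => group k σ i = h), F h σ) := by
    rw [← Finset.sum_fiberwise A (fun σ => group k σ i)]
    refine Finset.sum_congr rfl fun h _ => ?_
    rw [← nsmul_eq_mul, ← Finset.sum_const, ← Finset.sum_add_distrib]
    refine Finset.sum_congr rfl fun σ hσ => ?_
    rw [(Finset.mem_filter.mp hσ).2]
  have e2 : A.card * (realCost t (fun h => (R h : ℝ)) / s.card)
      = ∑ h, ((A.filter fun σ => group k σ i = h).card : ℝ) * t.depth h.val := by
    rw [realCost, Finset.sum_div, Finset.mul_sum]
    refine Finset.sum_congr rfl fun h _ => ?_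
    rw [hA.card_filter_div hi h]
    ring
  have e3 : A.card * μ = ∑ h, ((A.filter fun σ => group k σ i = h).card : ℝ) * μ := by
    rw [← Finset.sum_mul, ← hc]
  rw [mul_add, e1, e2, e3, Finset.sum_add_distrib, add_sub_add_left_eq_sub,
    ← Finset.sum_sub_distrib, Finset.mul_sum]
  refine (Finset.abs_sum_le_sum_abs _ _).trans (Finset.sum_le_sum fun h _ => ?_)
  rw [← mul_assoc, mul_comm (A.card : ℝ), ← hA.card_filter_div hi h]
  rcases (A.filter fun σ => group k σ i = h).eq_empty_or_nonempty with he | hne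
  · simp [he]
  · exact hF h hne

end IsExchangeable

theorem cast_sub_single {k : ℕ} {R : Fin (k + 1) → ℕ} {h : Fin (k + 1)} (hR : 0 < R h) :
    (fun h' => (((R - Pi.single h 1 : Fin (k + 1) → ℕ) h' : ℕ) : ℝ))
      = fun h' => (R h' : ℝ) - (Pi.single h 1 : Fin (k + 1) → ℝ) h' := by
  funext h'
  by_cases hh : h' = h
  · subst hh
    simp [Nat.cast_sub (Nat.succ_le_of_lt hR)]
  · simp [Pi.single_eq_of_ne hh]

theorem add_single_add_sub_single {k : ℕ} (c : Fin (k + 1) → ℕ) {R : Fin (k + 1) → ℕ}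
    {h : Fin (k + 1)} (hR : 0 < R h) : c + Pi.single h 1 + (R - Pi.single h 1) = c + R := by
  funext h'
  by_cases hh : h' = h
  · subst hh
    simp only [Pi.add_apply, Pi.sub_apply, Pi.single_eq_same]
    omega
  · simp [Pi.single_eq_of_ne hh]

/-- U/J plus the harmonic sum below J is a potential: it pays for the error term U/J² of the current
step and the expected potential after it. For J = 1 the divisions by 0 give 0. -/
theorem deviation_div_add_le {J : ℕ} (hJ : 0 < J) {U V : ℝ}
    (hV : V ≤ (1 - 1 / (J : ℝ)) ^ 2 * U + 1) :
    U / (J : ℝ) ^ 2 + V / ((J - 1 : ℕ) : ℝ) ≤ U / J + ((J - 1 : ℕ) : ℝ)⁻¹ := by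
  obtain ⟨j, rfl⟩ : ∃ j, J = j + 1 := ⟨J - 1, by omega⟩
  rcases Nat.eq_zero_or_pos j with rfl | hj
  · simp
  · have hj' : (0 : ℝ) < j := by exact_mod_cast hj
    rw [Nat.add_sub_cancel]
    have h1 : V / (j : ℝ) ≤ ((1 - 1 / ((j + 1 : ℕ) : ℝ)) ^ 2 * U + 1) / j := by gcongr
    have h2 : U / ((j + 1 : ℕ) : ℝ) ^ 2 + ((1 - 1 / ((j + 1 : ℕ) : ℝ)) ^ 2 * U + 1) / j
        = U / ((j + 1 : ℕ) : ℝ) + (j : ℝ)⁻¹ := by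
      push_cast
      field_simp
      ring
    linarith

namespace IsExchangeable

variable {n k : ℕ} {s : Finset (Fin n)} {R : Fin (k + 1) → ℕ} {A : Finset (Equiv.Perm (Fin n))}

theorem sum_mul_deviation_child_le (hA : IsExchangeable s R A) (hne : A.Nonempty) {i : Fin n}
    (hi : i ∈ s) (q : Fin (k + 1) → ℝ) :
    ∑ h, (R h : ℝ) / s.card * deviation q ((s.erase i).card : ℝ)
        (fun h' => (((R - Pi.single h 1 : Fin (k + 1) → ℕ) h' : ℕ) : ℝ))
      ≤ (1 - 1 / (s.card : ℝ)) ^ 2 * deviation q s.card (fun h => (R h : ℝ)) + 1 := by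
  have hs : 0 < s.card := Finset.card_pos.mpr ⟨i, hi⟩
  have hR : ∑ h, (R h : ℝ) = s.card := by exact_mod_cast hA.sum_eq hne
  refine le_of_eq_of_le (Finset.sum_congr rfl fun h _ => ?_)
    (sum_mul_deviation_le q (fun h => (R h : ℝ)) (by exact_mod_cast hs) hR)
  rcases Nat.eq_zero_or_pos (R h) with h0 | h0
  · simp [h0]
  · rw [cast_sub_single h0, Finset.card_erase_of_mem hi, Nat.cast_sub hs, Nat.cast_one]

theorem sum_div_card (hA : IsExchangeable s R A) (hne : A.Nonempty) {i : Fin n}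
    (hi : i ∈ s) : ∑ h, (R h : ℝ) / s.card = 1 := by
  have hs : (s.card : ℝ) ≠ 0 := by
    exact_mod_cast (Finset.card_pos.mpr ⟨i, hi⟩).ne'
  rw [← Finset.sum_div, div_eq_one_iff_eq hs]
  exact_mod_cast hA.sum_eq hne

end IsExchangeable

/-! ### Trees that are nearly optimal at every node -/

/-- If the comparison tree at every node has cost close to `μ` per unclassified element as long as
the unclassified elements have proportions close to `q`, then the total is close to `μ` per
element. -/
theorem ClassificationTree.abs_sum_comparisons_sub_le {n k : ℕ} {s : Finset (Fin n)}
    (T : ClassificationTree k s) {P : (Fin (k + 1) → ℕ) → ComparisonTree k → Prop}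
    {a : Fin (k + 1) → ℕ} {q : Fin (k + 1) → ℝ} {μ l : ℝ} (hl : 0 < l)
    (hP : ∀ (c R : Fin (k + 1) → ℕ) (t : ComparisonTree k) (j : ℕ), c + R = a → ∑ h, R h = j →
      P c t → |realCost t (fun h => (R h : ℝ)) - j * μ| ≤ k * ∑ h, |(R h : ℝ) - j * q h|)
    {c R : Fin (k + 1) → ℕ} {A : Finset (Equiv.Perm (Fin n))} (hA : IsExchangeable s R A)
    (hc : c + R = a) (hT : T.AllNodes P c) :
    |∑ σ ∈ A, (T.comparisons (group k σ) : ℝ) - A.card * (s.card * μ)|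
      ≤ A.card * (k / 2 * ((k + 1) * s.card / l
        + l * (deviation q s.card (fun h => (R h : ℝ)) / s.card
          + ∑ i ∈ Finset.range s.card, (i : ℝ)⁻¹))) := by
  induction T generalizing c R A with
  | leaf => simp [ClassificationTree.comparisons]
  | @node s i hi t child ih =>
    rcases A.eq_empty_or_nonempty with rfl | hne
    · simp
    obtain ⟨hPt, hch⟩ := hT
    have hs : 0 < s.card := Finset.card_pos.mpr ⟨i, hi⟩
    have hs' : (0 : ℝ) < s.card := by exact_mod_cast hs
    have hcard : (s.erase i).card = s.card - 1 := Finset.card_erase_of_mem hi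
    have step := hA.abs_sum_node_sub_le hi t
      (fun h σ => ((child h).comparisons (group k σ) : ℝ)) ((s.erase i).card * μ) _
      (fun h hh => by
        have hp := hA.pos_of_mem_filter hi hh
        exact ih h (hA.child hi h) (by rw [add_single_add_sub_single c hp, hc]) (hch h))
    have e : ∑ σ ∈ A, ((ClassificationTree.node i hi t child).comparisons (group k σ) : ℝ)
        = ∑ σ ∈ A, ((t.depth (group k σ i).val : ℝ)
          + ((child (group k σ i)).comparisons (group k σ) : ℝ)) := by
      simp [ClassificationTree.comparisons]
    rw [e]
    set X := ∑ σ ∈ A, ((t.depth (group k σ i).val : ℝ)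
          + ((child (group k σ i)).comparisons (group k σ) : ℝ))
    have hdev := hA.sum_mul_deviation_child_le hne hi q
    have hone := hA.sum_div_card hne hi
    have hcost := hP c R t s.card hc (hA.sum_eq hne) hPt
    have hcost' : |realCost t (fun h => (R h : ℝ)) / s.card - μ|
        ≤ k * (1 / 2 * ((k + 1) / l + l * (deviation q s.card (fun h => (R h : ℝ)) / s.card ^ 2))) := by
      refine le_trans ?_ (mul_le_mul_of_nonneg_left
        (sum_abs_div_le q s.card (fun h => (R h : ℝ)) hl hs') (Nat.cast_nonneg k))
      rw [← mul_div_assoc, le_div_iff₀ hs', ← abs_of_pos hs', ← abs_mul, abs_of_pos hs', sub_mul,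
        div_mul_cancel₀ _ hs'.ne', mul_comm μ]
      exact hcost
    have hc1 : ((s.erase i).card : ℝ) = s.card - 1 := by
      rw [hcard, Nat.cast_sub hs, Nat.cast_one]
    have hsplit : X - A.card * (s.card * μ)
        = (X - A.card * (realCost t (fun h => (R h : ℝ)) / s.card + (s.erase i).card * μ))
          + A.card * (realCost t (fun h => (R h : ℝ)) / s.card - μ) := by
      rw [hc1]; ring
    rw [hsplit]
    refine (abs_add_le _ _).trans ?_
    rw [abs_mul, Nat.abs_cast]
    refine (add_le_add step (mul_le_mul_of_nonneg_left hcost' (Nat.cast_nonneg _))).trans ?_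
    rw [← mul_add]
    refine mul_le_mul_of_nonneg_left ?_ (Nat.cast_nonneg _)
    have hB : ∑ i ∈ Finset.range s.card, (i : ℝ)⁻¹
        = ∑ i ∈ Finset.range (s.card - 1), (i : ℝ)⁻¹ + ((s.card - 1 : ℕ) : ℝ)⁻¹ := by
      conv_lhs => rw [← Nat.sub_add_cancel hs]
      rw [Finset.sum_range_succ]
    have hkey := deviation_div_add_le hs hdev
    -- The inductive bound is affine in the child's deviation and the outcome probabilities sum to
    -- 1, so averaging only replaces the deviation by its mean.
    have hlin : ∀ D : Fin (k + 1) → ℝ, ∀ b y : ℝ,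
        ∑ h, (R h : ℝ) / s.card * (k / 2 * (y + l * (D h / ((s.card - 1 : ℕ) : ℝ) + b)))
        = k / 2 * (y + l * ((∑ h, (R h : ℝ) / s.card * D h) / ((s.card - 1 : ℕ) : ℝ) + b)) := by
      intro D b y
      have : ∀ h, (R h : ℝ) / s.card * (k / 2 * (y + l * (D h / ((s.card - 1 : ℕ) : ℝ) + b)))
          = (R h : ℝ) / s.card * (k / 2 * (y + l * b))
            + k / 2 * l / ((s.card - 1 : ℕ) : ℝ) * ((R h : ℝ) / s.card * D h) := by
        intro h; ring
      rw [Finset.sum_congr rfl fun h _ => this h, Finset.sum_add_distrib, ← Finset.sum_mul, hone,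
        ← Finset.mul_sum]
      ring
    rw [hcard] at hkey ⊢
    rw [hlin, hB]
    have hc2 : ((s.card - 1 : ℕ) : ℝ) = s.card - 1 := by rw [← hcard, hc1]
    have hfac : (0 : ℝ) ≤ k / 2 * l := by positivity
    have hfin := mul_le_mul_of_nonneg_left hkey hfac
    have hy : (k + 1 : ℝ) * ((s.card - 1 : ℕ) : ℝ) / l
        = (k + 1) * s.card / l - (k + 1) / l := by
      rw [hc2]; ring
    rw [hy]
    linarith

/-! ### Sampling, then a fixed tree -/

theorem ClassificationTree.comparisons_of_allNodes_eq {n k : ℕ} {s : Finset (Fin n)}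
    (T : ClassificationTree k s) {t : ComparisonTree k} {c : Fin (k + 1) → ℕ}
    (hT : T.AllNodes (fun _ t' => t' = t) c) (g : Fin n → Fin (k + 1)) :
    T.comparisons g = ∑ i ∈ s, t.depth (g i).val := by
  induction T generalizing c with
  | leaf => simp [ClassificationTree.comparisons]
  | @node s i hi t' child ih =>
    obtain ⟨rfl, hch⟩ := hT
    rw [ClassificationTree.comparisons, ih _ (hch (g i)), ← Finset.add_sum_erase s _ hi]

theorem sum_depth_group_eq {n k : ℕ} {s : Finset (Fin n)} {R : Fin (k + 1) → ℕ}
    {A : Finset (Equiv.Perm (Fin n))} (hA : IsExchangeable s R A) (t : ComparisonTree k)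
    {σ : Equiv.Perm (Fin n)} (hσ : σ ∈ A) :
    ∑ i ∈ s, t.depth (group k σ i).val = cost t R := by
  rw [cost, ← Finset.sum_fiberwise s (group k σ)]
  refine Finset.sum_congr rfl fun h _ => ?_
  rw [Finset.sum_congr rfl fun i hi => by rw [(Finset.mem_filter.mp hi).2], Finset.sum_const,
    hA.count σ hσ h, smul_eq_mul, mul_comm]

theorem samplesThenFixes_zero {n k : ℕ} {s : Finset (Fin n)} {T : ClassificationTree k s}
    {t₀ : ComparisonTree k} {c : Fin (k + 1) → ℕ} (h : T.SamplesThenFixes t₀ 0 c) :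
    ∃ t, IsCostMinimal c t ∧ T.AllNodes (fun _ t' => t' = t) c := by
  cases T <;> exact h

/-- A comparison tree that is optimal for a sample `c` is almost optimal for the whole input. -/
theorem abs_cost_sub_cost_le {k : ℕ} {a c R : Fin (k + 1) → ℕ} {t u : ComparisonTree k}
    (hc : c + R = a) (ht : IsCostMinimal c t) (hu : IsCostMinimal a u) {S j m : ℕ} (hS : 0 < S)
    (hcS : ∑ h, c h = S) (hRj : ∑ h, R h = j) (hm : ∑ h, a h = m) {l : ℝ} (hl : 0 < l) :
    |(cost t a : ℝ) - cost u a|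
      ≤ m * k * ((k + 1) / l
        + l * (deviation (fun h => (a h : ℝ) / m) j (fun h => (R h : ℝ)) / (S : ℝ) ^ 2)) := by
  have hSm : m = S + j := by
    rw [← hm, ← hc, ← hcS, ← hRj, ← Finset.sum_add_distrib]; rfl
  have hS' : (0 : ℝ) < S := by exact_mod_cast hS
  have hm' : (0 : ℝ) < m := by exact_mod_cast (by omega : 0 < m)
  have hmS : (m : ℝ) = S + j := by exact_mod_cast hSm
  have ha : ∀ h, (a h : ℝ) = c h + R h := fun h => by rw [← hc]; simp
  have hmin : (cost u a : ℝ) ≤ cost t a := by exact_mod_cast hu t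
  have hminc : realCost t (fun h => (c h : ℝ)) ≤ realCost u (fun h => (c h : ℝ)) := by
    rw [← cast_cost, ← cast_cost]; exact_mod_cast ht u
  -- Scaling the sample up by m/S errs by a - (m/S)c = (m/S)(R - (j/m)a). Used for both `t` and `u`,
  -- this doubles the error and cancels the 1/2 of `sum_abs_div_le`.
  have key : ∀ v : ComparisonTree k,
      |realCost v (fun h => (a h : ℝ)) - m / S * realCost v (fun h => (c h : ℝ))|
        ≤ m * k * ((∑ h, |(R h : ℝ) - j * ((a h : ℝ) / m)|) / S) := by
    intro v
    rw [← realCost_smul]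
    refine (abs_realCost_sub_le v _ _).trans (le_of_eq ?_)
    have : ∀ h, |(a h : ℝ) - m / S * c h| = m / S * |(R h : ℝ) - j * ((a h : ℝ) / m)| := by
      intro h
      rw [← abs_of_pos (div_pos hm' hS'), ← abs_mul, abs_of_pos (div_pos hm' hS')]
      congr 1
      rw [ha h]
      field_simp
      rw [hmS]
      ring
    rw [Finset.sum_congr rfl fun h _ => this h, ← Finset.mul_sum]
    ring
  have hdev := mul_le_mul_of_nonneg_left (sum_abs_div_le (fun h => (a h : ℝ) / m) j
    (fun h => (R h : ℝ)) hl hS') (by positivity : (0 : ℝ) ≤ m * k)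
  have h1 := (abs_le.mp (key t)).2
  have h2 := (abs_le.mp (key u)).1
  have h3 := mul_le_mul_of_nonneg_left hminc (div_pos hm' hS').le
  rw [abs_of_nonneg (by linarith), cast_cost, cast_cost]
  linarith

/-- Once the tree is fixed, the count is `cost t R` for every input in `A`. Adding the sample's
share, at most k·S, turns it into `cost t a`. -/
theorem ClassificationTree.abs_sum_comparisons_sub_le_of_fixed {n k : ℕ}
    {s : Finset (Fin n)} (T : ClassificationTree k s) {t₀ u : ComparisonTree k}
    {a : Fin (k + 1) → ℕ} {S m : ℕ} {l : ℝ} (hS : 0 < S) (hl : 0 < l)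
    (hm : ∑ h, a h = m) (hu : IsCostMinimal a u)
    {c R : Fin (k + 1) → ℕ} {A : Finset (Equiv.Perm (Fin n))} (hA : IsExchangeable s R A)
    (hne : A.Nonempty) (hc : c + R = a) (hcS : ∑ h, c h = S) (hT : T.SamplesThenFixes t₀ 0 c) :
    |∑ σ ∈ A, (T.comparisons (group k σ) : ℝ) - A.card * (cost u a : ℝ)|
      ≤ A.card * (k * S + m * k * ((k + 1) / l
        + l * (deviation (fun h => (a h : ℝ) / m) s.card (fun h => (R h : ℝ))
          / (S : ℝ) ^ 2))) := by
  obtain ⟨t, ht, hall⟩ := samplesThenFixes_zero hT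
  have e : ∀ σ ∈ A, (T.comparisons (group k σ) : ℝ) = cost t R := fun σ hσ => by
    rw [T.comparisons_of_allNodes_eq hall, sum_depth_group_eq hA t hσ]
  rw [Finset.sum_congr rfl e, Finset.sum_const, nsmul_eq_mul, ← mul_sub, abs_mul, Nat.abs_cast]
  refine mul_le_mul_of_nonneg_left ?_ (Nat.cast_nonneg _)
  have h1 := abs_cost_sub_cost_le hc ht hu hS hcS (hA.sum_eq hne) hm hl
  have h2 : cost t a = cost t c + cost t R := by
    rw [← hc]
    simp [cost, mul_add, Finset.sum_add_distrib]
  have h3 : (cost t c : ℝ) ≤ k * S := by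
    have := cost_le t c
    rw [hcS] at this
    exact_mod_cast this
  have h4 : |(cost t R : ℝ) - cost u a| ≤ |(cost t a : ℝ) - cost u a| + cost t c := by
    have : (cost t R : ℝ) - cost u a = (cost t a - cost u a) - cost t c := by
      rw [h2]; push_cast; ring
    rw [this]
    exact (abs_sub _ _).trans (by rw [Nat.abs_cast])
  linarith

/-- After a sample of `S` elements, with the expected squared deviation at most `S`, the total is
close to the minimal cost. -/
theorem ClassificationTree.abs_sum_comparisons_sub_le_of_samplesThenFixes {n k : ℕ}
    {s : Finset (Fin n)} (T : ClassificationTree k s) {t₀ u : ComparisonTree k}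
    {a : Fin (k + 1) → ℕ} {S r m : ℕ} {l : ℝ} (hS : 0 < S) (hl : 0 < l)
    (hm : ∑ h, a h = m) (hu : IsCostMinimal a u)
    {c R : Fin (k + 1) → ℕ} {A : Finset (Equiv.Perm (Fin n))} (hA : IsExchangeable s R A)
    (hc : c + R = a) (hcS : ∑ h, c h + r = S) (hT : T.SamplesThenFixes t₀ r c) :
    |∑ σ ∈ A, (T.comparisons (group k σ) : ℝ) - A.card * (cost u a : ℝ)|
      ≤ A.card * (k * r + k * S + m * k * ((k + 1) / l
        + l * ((deviation (fun h => (a h : ℝ) / m) s.card (fun h => (R h : ℝ)) + r)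
          / (S : ℝ) ^ 2))) := by
  induction T generalizing c R A r with
  | leaf =>
    rcases A.eq_empty_or_nonempty with rfl | hne
    · simp
    cases r with
    | zero =>
      have h := ClassificationTree.abs_sum_comparisons_sub_le_of_fixed _ hS hl hm hu hA hne hc
        (by simpa using hcS) hT
      simpa using h
    -- The input ran out before the sample was complete: then m ≤ S and the minimal cost is itself
    -- at most k·S.
    | succ r =>
      have hR : ∑ h, R h = 0 := hA.sum_eq hne
      have hac : ∑ h, a h ≤ S := by
        rw [← hc]
        simp only [Pi.add_apply, Finset.sum_add_distrib]
        omega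
      have h1 : (cost u a : ℝ) ≤ k * S := by
        exact_mod_cast (cost_le u a).trans (Nat.mul_le_mul_left _ hac)
      have h2 := deviation_nonneg (fun h => (a h : ℝ) / m) ((∅ : Finset (Fin n)).card : ℝ)
        (fun h => (R h : ℝ))
      simp only [ClassificationTree.comparisons, Nat.cast_zero, Finset.sum_const_zero, zero_sub,
        abs_neg, abs_mul, Nat.abs_cast]
      refine mul_le_mul_of_nonneg_left ?_ (Nat.cast_nonneg _)
      have h3 : (0 : ℝ) ≤ k * (r + 1 : ℕ) := by positivity
      refine h1.trans ?_
      rw [add_assoc]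
      refine le_add_of_nonneg_of_le h3 (le_add_of_nonneg_right ?_)
      positivity
  | @node s i hi t child ih =>
    rcases A.eq_empty_or_nonempty with rfl | hne
    · simp
    cases r with
    | zero =>
      have h := ClassificationTree.abs_sum_comparisons_sub_le_of_fixed _ hS hl hm hu hA hne hc
        (by simpa using hcS) hT
      simpa using h
    | succ r =>
      obtain ⟨rfl, hch⟩ := hT
      have hs : (0 : ℝ) < s.card := by exact_mod_cast Finset.card_pos.mpr ⟨i, hi⟩
      have hs1 : (1 : ℝ) ≤ s.card := by exact_mod_cast Finset.card_pos.mpr ⟨i, hi⟩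
      have step := hA.abs_sum_node_sub_le hi t
        (fun h σ => ((child h).comparisons (group k σ) : ℝ)) (cost u a) _
        (fun h hh => by
          have hp := hA.pos_of_mem_filter hi hh
          refine ih h (r := r) (hA.child hi h) (by rw [add_single_add_sub_single c hp, hc]) ?_
            (hch h)
          simp only [Pi.add_apply, Finset.sum_add_distrib, Finset.sum_pi_single',
            Finset.mem_univ, if_true]
          omega)
      have e : ∑ σ ∈ A, ((ClassificationTree.node i hi t child).comparisons (group k σ) : ℝ)
          = ∑ σ ∈ A, ((t.depth (group k σ i).val : ℝ)
            + ((child (group k σ i)).comparisons (group k σ) : ℝ)) := by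
        simp [ClassificationTree.comparisons]
      rw [e]
      set X := ∑ σ ∈ A, ((t.depth (group k σ i).val : ℝ)
            + ((child (group k σ i)).comparisons (group k σ) : ℝ))
      have hdev := hA.sum_mul_deviation_child_le hne hi (fun h => (a h : ℝ) / m)
      have hone := hA.sum_div_card hne hi
      have hU := deviation_nonneg (fun h => (a h : ℝ) / m) s.card (fun h => (R h : ℝ))
      have hcost : |realCost t (fun h => (R h : ℝ)) / s.card| ≤ k := by
        rw [← cast_cost, abs_of_nonneg (by positivity), div_le_iff₀ hs]
        have := cost_le t R
        rw [hA.sum_eq hne] at this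
        exact_mod_cast this
      have hsplit : X - A.card * (cost u a : ℝ)
          = (X - A.card * (realCost t (fun h => (R h : ℝ)) / s.card + cost u a))
            + A.card * (realCost t (fun h => (R h : ℝ)) / s.card) := by ring
      rw [hsplit]
      refine (abs_add_le _ _).trans ?_
      rw [abs_mul, Nat.abs_cast]
      refine (add_le_add step (mul_le_mul_of_nonneg_left hcost (Nat.cast_nonneg _))).trans ?_
      rw [← mul_add]
      refine mul_le_mul_of_nonneg_left ?_ (Nat.cast_nonneg _)
      have hlin : ∀ D : Fin (k + 1) → ℝ, ∀ x y z w : ℝ,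
          ∑ h, (R h : ℝ) / s.card * (x + m * k * (y + l * ((D h + z) / w)))
          = x + m * k * (y + l * ((∑ h, (R h : ℝ) / s.card * D h + z) / w)) := by
        intro D x y z w
        have : ∀ h, (R h : ℝ) / s.card * (x + m * k * (y + l * ((D h + z) / w)))
            = (R h : ℝ) / s.card * (x + m * k * (y + l * (z / w)))
              + m * k * l / w * ((R h : ℝ) / s.card * D h) := by
          intro h; ring
        rw [Finset.sum_congr rfl fun h _ => this h, Finset.sum_add_distrib, ← Finset.sum_mul, hone,
          ← Finset.mul_sum]
        ring
      rw [hlin]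
      set U := deviation (fun h => (a h : ℝ) / m) s.card (fun h => (R h : ℝ))
      have hle1 : (1 - 1 / (s.card : ℝ)) ^ 2 ≤ 1 := by
        have h1 : 1 / (s.card : ℝ) ≤ 1 := (div_le_one hs).mpr hs1
        have h2 : 0 < 1 / (s.card : ℝ) := by positivity
        exact pow_le_one₀ (by linarith) (by linarith)
      -- During sampling the contraction factor is dropped: each draw adds at most 1 to the expected
      -- deviation, which the decrease of `r` absorbs.
      have hdev' := hdev.trans (add_le_add_left (mul_le_of_le_one_left hU hle1) 1)
      have hfin : ∀ V : ℝ, V ≤ U + 1 → (k : ℝ) * r + k * S + m * k * ((k + 1) / l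
          + l * ((V + r) / (S : ℝ) ^ 2)) + k ≤ k * (r + 1 : ℕ) + k * S + m * k * ((k + 1) / l
          + l * ((U + (r + 1 : ℕ)) / (S : ℝ) ^ 2)) := by
        intro V hV
        have h1 : m * k * ((k + 1) / l + l * ((V + r) / (S : ℝ) ^ 2))
            ≤ m * k * ((k + 1) / l + l * ((U + (r + 1 : ℕ)) / (S : ℝ) ^ 2)) := by
          have : V + r ≤ U + (r + 1 : ℕ) := by push_cast; linarith
          gcongr
        have h2 : (k : ℝ) * (r + 1 : ℕ) = k * r + k := by push_cast; ring
        linarith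
      exact hfin _ hdev'

/-! ### Averaging over group sizes and the final bound -/

theorem isExchangeable_groupSize {n : ℕ} (k : ℕ) (a : Fin (k + 1) → ℕ) :
    IsExchangeable (nonPivots n k) a
      (Finset.univ.filter fun σ : Equiv.Perm (Fin n) => groupSize k σ = a) where
  subset := Finset.Subset.refl _
  swap := by
    intro i hi j hj σ hσ
    simp only [Finset.mem_filter, Finset.mem_univ, true_and] at hσ ⊢
    rw [← hσ]
    funext h
    have hmem : ∀ x ∈ nonPivots n k, Equiv.swap i j x ∈ nonPivots n k := by
      intro x hx
      rw [Equiv.swap_apply_def]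
      split_ifs <;> assumption
    refine Finset.card_bij (fun x _ => Equiv.swap i j x) ?_
      (fun x _ y _ e => (Equiv.swap i j).injective e) ?_
    · intro x hx
      rw [Finset.mem_filter, group_mul_swap hi hj] at hx
      exact Finset.mem_filter.mpr ⟨hmem x hx.1, hx.2⟩
    · intro x hx
      rw [Finset.mem_filter] at hx
      refine ⟨Equiv.swap i j x, ?_, by simp⟩
      rw [Finset.mem_filter, group_mul_swap hi hj]
      exact ⟨hmem x hx.1, by simpa using hx.2⟩
  count := by
    intro σ hσ h
    rw [← (Finset.mem_filter.mp hσ).2]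
    rfl

theorem card_nonPivots {n k : ℕ} (hk : k ≤ n) : (nonPivots n k).card = n - k := by
  have h : (nonPivots n k).card + (Finset.univ.filter fun i : Fin n => i.val < k).card = n := by
    rw [nonPivots, add_comm]
    simp_rw [← not_lt]
    rw [Finset.card_filter_add_card_filter_not, Finset.card_univ, Fintype.card_fin]
  have h2 : (Finset.univ.filter fun i : Fin n => i.val < k).card = k := by
    rw [Fin.card_filter_val_lt]
    exact min_eq_right hk
  omega

theorem abs_avgComparisons_sub_le {n k : ℕ} (S S' : Strategy k n) {E : ℝ}
    (h : ∀ a, (Finset.univ.filter fun σ : Equiv.Perm (Fin n) => groupSize k σ = a).Nonempty →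
      |∑ σ ∈ Finset.univ.filter (fun σ : Equiv.Perm (Fin n) => groupSize k σ = a),
          ((S a).comparisons (group k σ) : ℝ)
        - ∑ σ ∈ Finset.univ.filter (fun σ : Equiv.Perm (Fin n) => groupSize k σ = a),
          ((S' a).comparisons (group k σ) : ℝ)|
        ≤ (Finset.univ.filter fun σ : Equiv.Perm (Fin n) => groupSize k σ = a).card * E) :
    |avgComparisons S - avgComparisons S'| ≤ E := by
  have hn : (0 : ℝ) < (n ! : ℝ) := by exact_mod_cast n.factorial_pos
  rw [avgComparisons, avgComparisons, ← sub_div, abs_div, abs_of_pos hn, div_le_iff₀ hn,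
    ← Finset.sum_sub_distrib]
  have hmaps : ∀ σ ∈ (Finset.univ : Finset (Equiv.Perm (Fin n))),
      groupSize k σ ∈ Finset.univ.image (groupSize k) :=
    fun σ hσ => Finset.mem_image_of_mem _ hσ
  have hcard : (n ! : ℝ) = ∑ a ∈ Finset.univ.image (groupSize (n := n) k),
      ((Finset.univ.filter fun σ : Equiv.Perm (Fin n) => groupSize k σ = a).card : ℝ) := by
    have := Finset.card_eq_sum_card_fiberwise hmaps
    rw [Finset.card_univ, Fintype.card_perm, Fintype.card_fin] at this
    exact_mod_cast this
  rw [← Finset.sum_fiberwise_of_maps_to hmaps, hcard, mul_comm, Finset.sum_mul]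
  refine (Finset.abs_sum_le_sum_abs _ _).trans (Finset.sum_le_sum fun a ha => ?_)
  obtain ⟨σ, -, hσ⟩ := Finset.mem_image.mp ha
  refine le_of_eq_of_le ?_ (h a ⟨σ, by simp [hσ]⟩)
  rw [← Finset.sum_sub_distrib]
  congr 1
  refine Finset.sum_congr rfl fun τ hτ => ?_
  rw [(Finset.mem_filter.mp hτ).2]

theorem deviation_self {k : ℕ} {a : Fin (k + 1) → ℕ} {m : ℕ} (hm : ∑ h, a h = m) :
    deviation (fun h => (a h : ℝ) / m) m (fun h => (a h : ℝ)) = 0 := by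
  refine Finset.sum_eq_zero fun h _ => ?_
  rcases Nat.eq_zero_or_pos m with rfl | h0
  · rw [Finset.sum_eq_zero_iff] at hm
    simp [hm h (Finset.mem_univ h)]
  · have : (m : ℝ) ≠ 0 := by exact_mod_cast h0.ne'
    rw [mul_div_cancel₀ _ this, sub_self, zero_pow two_ne_zero]

/-- A comparison tree with minimal cost for `a`, or with minimal cost for the unclassified
elements, has cost close to the average if the proportions of the unclassified elements are
close to those of `a`. -/
theorem abs_realCost_sub_mul_le {k : ℕ} {a R : Fin (k + 1) → ℕ} {t u : ComparisonTree k}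
    (hu : IsCostMinimal a u) {m j : ℕ} (ht : IsCostMinimal R t ∨ IsCostMinimal a t) :
    |realCost t (fun h => (R h : ℝ)) - j * ((cost u a : ℝ) / m)|
      ≤ k * ∑ h, |(R h : ℝ) - j * ((a h : ℝ) / m)| := by
  have e : ∀ v : ComparisonTree k, realCost v (fun h => j * ((a h : ℝ) / m))
      = j * ((cost v a : ℝ) / m) := by
    intro v
    have : (fun h => j * ((a h : ℝ) / m)) = fun h => (j / m : ℝ) * a h := by funext h; ring
    rw [this, realCost_smul, cast_cost]
    ring
  have h1 := abs_le.mp (abs_realCost_sub_le t (fun h => (R h : ℝ)) fun h => j * ((a h : ℝ) / m))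
  have h2 := abs_le.mp (abs_realCost_sub_le u (fun h => (R h : ℝ)) fun h => j * ((a h : ℝ) / m))
  rw [e] at h1 h2
  have hmin : (j : ℝ) * ((cost u a : ℝ) / m) ≤ j * ((cost t a : ℝ) / m) := by
    have : (cost u a : ℝ) ≤ cost t a := by exact_mod_cast hu t
    gcongr
  rw [abs_le]
  rcases ht with ht | ht
  · have : realCost t (fun h => (R h : ℝ)) ≤ realCost u (fun h => (R h : ℝ)) := by
      rw [← cast_cost, ← cast_cost]; exact_mod_cast ht u
    constructor <;> linarith
  · have : cost t a = cost u a := le_antisymm (ht u) (hu t)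
    rw [this] at h1
    exact h1

/-- The common error bound, with `x = n^{1/4}`. -/
theorem abs_avgComparisons_sub_le_of_isCostMinimal {n k : ℕ} (hk : 1 ≤ k) (hn : k ≤ n)
    {t₀ : ComparisonTree k} {T : ClassificationTree k (nonPivots n k)} (hT : IsSP t₀ T)
    {S : Strategy k n}
    (P : (Fin (k + 1) → ℕ) → (Fin (k + 1) → ℕ) → ComparisonTree k → Prop)
    (hP : ∀ (a c R : Fin (k + 1) → ℕ) (t : ComparisonTree k), c + R = a → P a c t →
      IsCostMinimal R t ∨ IsCostMinimal a t)
    (hS : ∀ a : Fin (k + 1) → ℕ, ∑ h, a h = n - k → (S a).AllNodes (P a) 0) :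
    |avgComparisons (fun _ => T) - avgComparisons S|
      ≤ (2 * k * (k + 7)) * (n : ℝ) ^ (1 - 1 / 4 : ℝ) := by
  obtain ⟨s₀, hs₀, hsamp⟩ := hT
  have hn1 : (1 : ℝ) ≤ n := by exact_mod_cast hk.trans hn
  have hn0 : (0 : ℝ) ≤ n := by linarith
  -- This is also the AM-GM parameter l in both estimates.
  set x : ℝ := (n : ℝ) ^ (1 / 4 : ℝ) with hx
  have hx1 : 1 ≤ x := Real.one_le_rpow hn1 (by norm_num)
  have hx0 : 0 < x := by linarith
  have hx3 : (n : ℝ) ^ (3 / 4 : ℝ) = x ^ 3 := by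
    rw [hx, ← Real.rpow_natCast, ← Real.rpow_mul hn0]; norm_num
  have hx4 : (n : ℝ) = x ^ 4 := by
    rw [hx, ← Real.rpow_natCast, ← Real.rpow_mul hn0]; norm_num
  rw [show (1 - 1 / 4 : ℝ) = 3 / 4 by norm_num, hx3]
  rw [hx3, abs_lt] at hs₀
  have hx31 : 1 ≤ x ^ 3 := one_le_pow₀ hx1
  have hs₀pos : 0 < s₀ := by
    have : (0 : ℝ) < s₀ := by linarith [hs₀.1]
    exact_mod_cast this
  have hs₀1 : (1 : ℝ) ≤ s₀ := by exact_mod_cast hs₀pos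
  have hk0 : (0 : ℝ) ≤ k := Nat.cast_nonneg k
  refine abs_avgComparisons_sub_le _ _ fun a ha => ?_
  have hA := isExchangeable_groupSize (n := n) k a
  have hcard := card_nonPivots hn
  have hsum : ∑ h, a h = n - k := by rw [hA.sum_eq ha, hcard]
  obtain ⟨u, hu⟩ := exists_isCostMinimal t₀ a
  have b1 := T.abs_sum_comparisons_sub_le_of_samplesThenFixes (S := s₀) hs₀pos hx0 hsum hu hA
    (zero_add a) (by simp) hsamp
  have b2 := (S a).abs_sum_comparisons_sub_le hx0
    (q := fun h => (a h : ℝ) / (n - k : ℕ)) (μ := (cost u a : ℝ) / (n - k : ℕ))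
    (fun c R t j hc _ ht => abs_realCost_sub_mul_le hu (hP a c R t hc ht)) hA (zero_add a)
    (hS a hsum)
  rw [hcard, deviation_self hsum] at b1 b2
  have hμ : ((n - k : ℕ) : ℝ) * ((cost u a : ℝ) / (n - k : ℕ)) = cost u a := by
    rcases Nat.eq_zero_or_pos (n - k) with h0 | h0
    · have : cost u a = 0 := by
        have := cost_le u a
        rw [hsum, h0] at this
        simpa using this
      simp [h0, this]
    · exact mul_div_cancel₀ _ (by exact_mod_cast h0.ne')
  rw [hμ] at b2
  set N : ℝ := ((Finset.univ.filter fun σ : Equiv.Perm (Fin n) => groupSize k σ = a).card : ℝ)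
    with hN
  have hm4 : ((n - k : ℕ) : ℝ) ≤ x ^ 4 := by
    rw [← hx4]; exact_mod_cast Nat.sub_le n k
  set m : ℝ := ((n - k : ℕ) : ℝ) with hm
  have hm0 : 0 ≤ m := Nat.cast_nonneg _
  -- The 7 is 4 + 1 + 2: s₀ ≤ 2x³ occurs twice, the 1 comes from k + 1, and the last term is 2x² ≤
  -- 2x³.
  have c1 : (k : ℝ) * s₀ + k * s₀ + m * k * ((k + 1) / x + x * ((0 + s₀) / (s₀ : ℝ) ^ 2))
      ≤ k * (k + 7) * x ^ 3 := by
    have h1 : (k : ℝ) * s₀ ≤ k * (2 * x ^ 3) := by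
      gcongr; linarith [hs₀.2]
    have h2 : (0 + (s₀ : ℝ)) / (s₀ : ℝ) ^ 2 ≤ 2 / x ^ 3 := by
      rw [div_le_div_iff₀ (by positivity) (by positivity), zero_add, sq, mul_left_comm]
      refine mul_le_mul_of_nonneg_left ?_ (by linarith)
      -- Adding s₀ > x³ - 1 and s₀ ≥ 1 gives 2s₀ > x³.
      linarith [hs₀.1]
    have h3 : m * k * ((k + 1) / x + x * ((0 + s₀) / (s₀ : ℝ) ^ 2))
        ≤ x ^ 4 * k * ((k + 1) / x + x * (2 / x ^ 3)) := by gcongr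
    have h4 : x ^ 4 * k * ((k + 1) / x + x * (2 / x ^ 3)) = k * ((k + 1) * x ^ 3 + 2 * x ^ 2) := by
      field_simp
    have h5 : x ^ 2 ≤ x ^ 3 := pow_le_pow_right₀ hx1 (by norm_num)
    have h6 := mul_le_mul_of_nonneg_left h5 hk0
    nlinarith
  have c2 : (k : ℝ) / 2 * ((k + 1) * m / x + x * (0 / m + ∑ i ∈ Finset.range (n - k), (i : ℝ)⁻¹))
      ≤ k * (k + 7) * x ^ 3 := by
    have h1 : ∑ i ∈ Finset.range (n - k), (i : ℝ)⁻¹ ≤ 2 * x ^ 2 := by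
      refine (sum_inv_le_two_mul_sqrt _).trans ?_
      gcongr
      rw [Real.sqrt_le_left (by positivity)]
      exact hm4.trans (le_of_eq (by ring))
    have h2 : (k : ℝ) / 2 * ((k + 1) * m / x
          + x * (0 / m + ∑ i ∈ Finset.range (n - k), (i : ℝ)⁻¹))
        ≤ k / 2 * ((k + 1) * x ^ 4 / x + x * (2 * x ^ 2)) := by
      rw [zero_div, zero_add]
      gcongr
    refine h2.trans ?_
    have h3 : (k : ℝ) / 2 * ((k + 1) * x ^ 4 / x + x * (2 * x ^ 2)) = k * ((k + 3) / 2) * x ^ 3 := by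
      field_simp
      ring
    rw [h3]
    gcongr
    linarith
  have hN0 : 0 ≤ N := Nat.cast_nonneg _
  have d1 := b1.trans (mul_le_mul_of_nonneg_left c1 hN0)
  have d2 := b2.trans (mul_le_mul_of_nonneg_left c2 hN0)
  rw [abs_le] at d1 d2 ⊢
  constructor <;> linarith [d1.1, d1.2, d2.1, d2.2]

end KPivot

theorem mainTheorem6 :
    ∃ ε : ℝ, 0 < ε ∧ ∀ k : ℕ, 1 ≤ k → ∃ C : ℝ, ∀ n : ℕ, k ≤ n →
      ∀ (t₀ : KPivot.ComparisonTree k) (T : KPivot.ClassificationTree k (KPivot.nonPivots n k)),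
        KPivot.IsSP t₀ T →
          (∀ S : KPivot.Strategy k n, KPivot.IsO S →
            |KPivot.avgComparisons (fun _ => T) - KPivot.avgComparisons S|
              ≤ C * (n : ℝ) ^ (1 - ε)) ∧
          (∀ S : KPivot.Strategy k n, KPivot.IsN S →
            |KPivot.avgComparisons (fun _ => T) - KPivot.avgComparisons S|
              ≤ C * (n : ℝ) ^ (1 - ε)) := by
  -- Each strategy is within k(k + 7) n^{3/4} of the minimal cost, hence the factor 2.
  refine ⟨1 / 4, by norm_num, fun k hk => ⟨2 * k * (k + 7), fun n hn t₀ T hT => ⟨?_, ?_⟩⟩⟩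
  · intro S hS
    refine KPivot.abs_avgComparisons_sub_le_of_isCostMinimal hk hn hT _ ?_ hS
    rintro a c R t rfl h
    have := h fun h' => Nat.le_add_right _ _
    rw [add_tsub_cancel_left] at this
    exact Or.inl this
  · intro S hS
    exact KPivot.abs_avgComparisons_sub_le_of_isCostMinimal hk hn hT
      (fun a _ t => KPivot.IsCostMinimal a t) (fun _ _ _ _ _ h => Or.inr h) hS
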